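/- A Jacobi matrix $J(a,b)$ is the doubly infinite symmetric tridiagonal matrix with real diagonal entries $b_n$ and positive off-diagonal entries $a_n$, acting on sequences $\varphi:\mathbb Z\to\mathbb C$ by $(J\varphi)(n)=a_{n-1}\varphi(n-1)+b_n\varphi(n)+a_n\varphi(n+1)$. The Marchenko class $\mathcal M$ is the set of all Jacobi matrices $J(a,b)$ with $$\sum_{n\in\mathbb Z}(1+|n|)\bigl(|a_n-\tfrac12|+|b_n|\bigr)<\infty ,$$ with the topology of the metric $d(J(a,b),J(a',b'))=\sum_{n\in\mathbb Z}(1+|n|)\bigl(|a_n-a'_n|+|b_n-b'_n|\bigr)$. For $L=J(a,b)\in\mathcal M$ and $|z|=1$, $z\ne\pm1$, let $\varphi^{\mathrm r}_{\pm}(z;\cdot)$ and $\varphi^{\mathrm l}_-(z;\cdot)$ be the Jost solutions of $L\varphi=\frac{z+z^{-1}}2\varphi$, that is, the solutions with $$\lim_{n\to+\infty}\varphi^{\mathrm r}_{\pm}(z;n)z^{\mp n}=1,\qquad \lim_{n\to-\infty}\varphi^{\mathrm l}_-(z;n)z^{n}=1 ,$$ let $W(\varphi,\psi)=a_n\bigl[\varphi(n)\psi(n+1)-\varphi(n+1)\psi(n)\bigr]$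 be the Wronskian of two solutions (independent of $n$), and define the reflection coefficient $$R_L(z)=\frac{W\bigl(\varphi^{\mathrm l}_-(z;\cdot),\varphi^{\mathrm r}_-(z;\cdot)\bigr)}{W\bigl(\varphi^{\mathrm r}_+(z;\cdot),\varphi^{\mathrm l}_-(z;\cdot)\bigr)} .$$ The values at $z=\pm1$ are understood by continuous extension: $R_L(\pm1)=-1$ means that $R_L(z)\to-1$ as $z\to 1$ and as $z\to-1$ along the unit circle, $z\neq\pm1$. **Theorem.** The set of all $L\in\mathcal M$ with $R_L(1)=R_L(-1)=-1$ is an open and dense subset of $\mathcal M$. -/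

import Mathlib

open Filter Topology

/-- The Marchenko class: doubly infinite Jacobi matrices `J(a, b)`, with positive off-diagonal
entries `a n` and diagonal entries `b n`, such that the sequences `a n - 1/2` and `b n` are
summable with weight `1 + |n|`. -/
@[ext]
structure MarchenkoJacobi where
  a : ℤ → ℝ
  b : ℤ → ℝ
  a_pos : ∀ n, 0 < a n
  summable_weighted : Summable fun n : ℤ => (1 + |(n : ℝ)|) * (|a n - 1 / 2| + |b n|)

namespace MarchenkoJacobi

/-- The weighted norm `∑ (1 + |n|) (|x n| + |y n|)` of a pair of sequences. -/
noncomputable def weightedNorm (x y : ℤ → ℝ) : ℝ :=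
  ∑' n : ℤ, (1 + |(n : ℝ)|) * (|x n| + |y n|)

theorem summable_sub (L M : MarchenkoJacobi) :
    Summable fun n : ℤ => (1 + |(n : ℝ)|) * (|(L.a - M.a) n| + |(L.b - M.b) n|) := by
  refine Summable.of_nonneg_of_le (fun n => by positivity) (fun n => ?_)
    (L.summable_weighted.add M.summable_weighted)
  have h1 : |L.a n - M.a n| ≤ |L.a n - 1 / 2| + |M.a n - 1 / 2| := by
    have h := abs_sub (L.a n - 1 / 2) (M.a n - 1 / 2)
    simpa using h
  have h2 : |L.b n - M.b n| ≤ |L.b n| + |M.b n| := abs_sub _ _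
  have h3 : (0 : ℝ) ≤ 1 + |(n : ℝ)| := by positivity
  rw [← mul_add]
  refine mul_le_mul_of_nonneg_left ?_ h3
  simp only [Pi.sub_apply]
  linarith

/-- The topology of the Marchenko class is that of the metric
`∑ (1 + |n|) (|a n - a' n| + |b n - b' n|)`, the weighted norm of the difference. -/
noncomputable instance : MetricSpace MarchenkoJacobi where
  dist L M := weightedNorm (L.a - M.a) (L.b - M.b)
  dist_self L := by simp [weightedNorm]
  dist_comm L M := by
    simp only [weightedNorm, Pi.sub_apply]
    exact tsum_congr fun n => by rw [abs_sub_comm, abs_sub_comm (L.b n)]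
  dist_triangle L M K := by
    simp only [weightedNorm]
    rw [← (summable_sub L M).tsum_add (summable_sub M K)]
    refine (summable_sub L K).tsum_le_tsum (fun n => ?_)
      ((summable_sub L M).add (summable_sub M K))
    rw [← mul_add]
    refine mul_le_mul_of_nonneg_left ?_ (by positivity)
    have h1 := abs_sub_le (L.a n) (M.a n) (K.a n)
    have h2 := abs_sub_le (L.b n) (M.b n) (K.b n)
    simp only [Pi.sub_apply]
    linarith
  eq_of_dist_eq_zero {L M} h := by
    have h0 := ((summable_sub L M).hasSum_iff.2 h)
    rw [hasSum_zero_iff_of_nonneg (fun n => by positivity)] at h0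
    have key : ∀ n : ℤ, L.a n = M.a n ∧ L.b n = M.b n := by
      intro n
      have hn := congrFun h0 n
      have hw : (1 + |(n : ℝ)|) ≠ 0 := by positivity
      simp only [Pi.sub_apply, Pi.zero_apply, mul_eq_zero, hw, false_or] at hn
      have h1 := abs_nonneg (L.a n - M.a n)
      have h2 := abs_nonneg (L.b n - M.b n)
      exact ⟨sub_eq_zero.1 (abs_eq_zero.1 (by linarith)),
        sub_eq_zero.1 (abs_eq_zero.1 (by linarith))⟩
    exact MarchenkoJacobi.ext (funext fun n => (key n).1) (funext fun n => (key n).2)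

/-- The action of the Jacobi matrix on a sequence:
`(L φ) n = a (n - 1) φ (n - 1) + b n φ n + a n φ (n + 1)`. -/
noncomputable def apply (L : MarchenkoJacobi) (φ : ℤ → ℂ) (n : ℤ) : ℂ :=
  (L.a (n - 1) : ℂ) * φ (n - 1) + (L.b n : ℂ) * φ n + (L.a n : ℂ) * φ (n + 1)

/-- `φ` solves `L φ = (z + z⁻¹) / 2 • φ` on all of `ℤ`. -/
def IsSolution (L : MarchenkoJacobi) (z : ℂ) (φ : ℤ → ℂ) : Prop :=
  ∀ n : ℤ, L.apply φ n = (z + z⁻¹) / 2 * φ n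

/-- `φ` solves `L φ = (z + z⁻¹) / 2 • φ` and `φ n * z ^ (-n) → 1` along `l`. -/
def IsJost (L : MarchenkoJacobi) (l : Filter ℤ) (z : ℂ) (φ : ℤ → ℂ) : Prop :=
  L.IsSolution z φ ∧ Tendsto (fun n : ℤ => φ n * z ^ (-n)) l (𝓝 1)

/-- The Jost solution with `φ n * z ^ (-n) → 1` as `n → +∞`. -/
noncomputable def jostRightPlus (L : MarchenkoJacobi) (z : ℂ) : ℤ → ℂ :=
  Classical.epsilon (L.IsJost atTop z)

/-- The Jost solution with `φ n * z ^ n → 1` as `n → +∞`. It solves the same equation, since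
`(z + z⁻¹) / 2` is unchanged under `z ↦ z⁻¹`. -/
noncomputable def jostRightMinus (L : MarchenkoJacobi) (z : ℂ) : ℤ → ℂ :=
  Classical.epsilon (L.IsJost atTop z⁻¹)

/-- The Jost solution with `φ n * z ^ n → 1` as `n → -∞`. -/
noncomputable def jostLeftMinus (L : MarchenkoJacobi) (z : ℂ) : ℤ → ℂ :=
  Classical.epsilon (L.IsJost atBot z⁻¹)

/-- The Wronskian `a n (φ n ψ (n + 1) - φ (n + 1) ψ n)`. -/
noncomputable def wronskian (L : MarchenkoJacobi) (φ ψ : ℤ → ℂ) (n : ℤ) : ℂ :=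
  (L.a n : ℂ) * (φ n * ψ (n + 1) - φ (n + 1) * ψ n)

/-- The Wronskian of two solutions for the same `z` does not depend on the site. -/
theorem wronskian_eq_zero_site (L : MarchenkoJacobi) {z : ℂ} {φ ψ : ℤ → ℂ}
    (hφ : L.IsSolution z φ) (hψ : L.IsSolution z ψ) (n : ℤ) :
    L.wronskian φ ψ n = L.wronskian φ ψ 0 := by
  have step : ∀ n : ℤ, L.wronskian φ ψ (n + 1) = L.wronskian φ ψ n := by
    intro n
    have h1 := hφ (n + 1)
    have h2 := hψ (n + 1)
    simp only [apply, add_sub_cancel_right] at h1 h2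
    simp only [wronskian]
    linear_combination φ (n + 1) * h2 - ψ (n + 1) * h1
  induction n with
  | zero => rfl
  | succ k ih => rw [step, ih]
  | pred k ih => rw [← ih, ← step (-(k : ℤ) - 1), sub_add_cancel]

/-- The reflection coefficient
`R z = W (φ₋ˡ z, φ₋ʳ z) / W (φ₊ʳ z, φ₋ˡ z)`, for `z ≠ 1, -1` on the unit circle; the Wronskians
do not depend on the site and are evaluated at the site `0`. -/
noncomputable def reflectionCoeff (L : MarchenkoJacobi) (z : ℂ) : ℂ :=
  L.wronskian (L.jostLeftMinus z) (L.jostRightMinus z) 0 /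
    L.wronskian (L.jostRightPlus z) (L.jostLeftMinus z) 0

/-- The reflection coefficient, a function on the unit circle without `1` and `-1`, has the value
`r` at the point `e` of the unit circle, by continuous extension from the circle if `e` is one of
the band edges `1`, `-1`. -/
def HasReflectionValue (L : MarchenkoJacobi) (e r : ℂ) : Prop :=
  Tendsto L.reflectionCoeff (𝓝[Metric.sphere (0 : ℂ) 1 \ {1, -1}] e) (𝓝 r)

end MarchenkoJacobi

namespace MarchenkoJacobi

/-! Let `w(z)` be the Wronskian of the right and left Jost solutions (`jostWronskian`), and let `e =
±1`. Everything rests on `R(e) = -1 ↔ w(e) ≠ 0` (`hasReflectionValue_iff`).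

If `w(e) ≠ 0`, continuity of the Jost solutions up to the edge suffices: since `e⁻¹ = e`, both right
solutions tend to the same one, and the quotient tends to `W(l, r) / W(r, l) = -1`. If `w(e) = 0`,
then `w(z) = O(z - e)` (`isBigO_jostWronskian`), while unitarity (`normSq_wronskian`) gives `1 -
|R|² = |z - z⁻¹|² / (4|w|²)`. This stays away from zero, so `R` cannot tend to `-1`.

Openness is continuity of `w(e)` in `L`. For density, when `w(e) = 0` there is a solution
asymptotically free at both ends; changing one diagonal entry where it is nonzero, by any nonzero
amount, makes `w(e)` nonzero (`jostWronskian_addDiag_ne_zero`).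

The analytic input is an a priori bound for the backward recursion, uniform over `|z| = 1` and
stable in `L` (`backward_bound`). Compactness along ultrafilters turns it into existence and, with
uniqueness, joint continuity of the Jost solutions. Only a first moment is available, so these
solutions need not be differentiable at the edge; the bound `O(z - e)` comes instead from following
a Wronskian over about `1 / |z - e|` sites (`norm_wronskian_edge_le`). -/

theorem IsSolution.eq {L : MarchenkoJacobi} {z : ℂ} {φ : ℤ → ℂ} (h : L.IsSolution z φ) (n : ℤ) :
    (L.a (n - 1) : ℂ) * φ (n - 1) + (L.b n : ℂ) * φ n + (L.a n : ℂ) * φ (n + 1) =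
      (z + z⁻¹) / 2 * φ n := h n

theorem a_ne_zero (L : MarchenkoJacobi) (n : ℤ) : (L.a n : ℂ) ≠ 0 :=
  Complex.ofReal_ne_zero.2 (L.a_pos n).ne'

theorem IsSolution.inv {L : MarchenkoJacobi} {z : ℂ} {φ : ℤ → ℂ} (h : L.IsSolution z φ) :
    L.IsSolution z⁻¹ φ := fun n => by rw [h n, inv_inv, add_comm]

theorem IsSolution.sub_smul {L : MarchenkoJacobi} {z : ℂ} {φ ψ : ℤ → ℂ} (hφ : L.IsSolution z φ)
    (hψ : L.IsSolution z ψ) (c : ℂ) : L.IsSolution z (fun n => φ n - c * ψ n) := fun n => by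
  have h1 := hφ.eq n
  have h2 := hψ.eq n
  simp only [apply]
  linear_combination h1 - c * h2

theorem IsSolution.eq_zero {L : MarchenkoJacobi} {z : ℂ} {φ : ℤ → ℂ} (h : L.IsSolution z φ)
    {m : ℤ} (h0 : φ m = 0) (h1 : φ (m + 1) = 0) (n : ℤ) : φ n = 0 := by
  have key : φ n = 0 ∧ φ (n + 1) = 0 := by
    induction n using Int.inductionOn' (b := m) with
    | zero => exact ⟨h0, h1⟩
    | succ k _ ih =>
      refine ⟨ih.2, ?_⟩
      have := h.eq (k + 1)
      rw [add_sub_cancel_right, ih.1, ih.2] at this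
      simpa [L.a_ne_zero] using this
    | pred k _ ih =>
      have := h.eq k
      rw [ih.1, ih.2] at this
      refine ⟨by simpa [L.a_ne_zero] using this, by simpa using ih.1⟩
  exact key.1

/-- Solutions with vanishing Wronskian are proportional. -/
theorem IsSolution.exists_eq_mul {L : MarchenkoJacobi} {z : ℂ} {φ ψ : ℤ → ℂ}
    (hφ : L.IsSolution z φ) (hψ : L.IsSolution z ψ) (hψ0 : ψ ≠ 0) {m : ℤ}
    (hW : L.wronskian φ ψ m = 0) : ∃ c : ℂ, ∀ n, φ n = c * ψ n := by
  have hW' : φ m * ψ (m + 1) - φ (m + 1) * ψ m = 0 := by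
    simpa [wronskian, L.a_ne_zero] using hW
  by_cases h0 : ψ m = 0
  · have h1 : ψ (m + 1) ≠ 0 := fun h1 => hψ0 (funext (hψ.eq_zero h0 h1))
    refine ⟨φ (m + 1) / ψ (m + 1), fun n => sub_eq_zero.1 ?_⟩
    refine (hφ.sub_smul hψ _).eq_zero (m := m) ?_ ?_ n
    · rw [h0] at hW' ⊢
      simpa [h1] using hW'
    · field_simp
      simp
  · refine ⟨φ m / ψ m, fun n => sub_eq_zero.1 ?_⟩
    refine (hφ.sub_smul hψ _).eq_zero (m := m) ?_ ?_ n
    · field_simp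
      simp
    · field_simp
      linear_combination -hW'

/-- Green's identity at one site, for two spectral parameters. -/
theorem wronskian_succ_sub (L : MarchenkoJacobi) {z w : ℂ} {φ ψ : ℤ → ℂ}
    (hφ : L.IsSolution z φ) (hψ : L.IsSolution w ψ) (n : ℤ) :
    L.wronskian φ ψ (n + 1) - L.wronskian φ ψ n =
      ((w + w⁻¹) / 2 - (z + z⁻¹) / 2) * (φ (n + 1) * ψ (n + 1)) := by
  have h1 := hφ.eq (n + 1)
  have h2 := hψ.eq (n + 1)
  simp only [add_sub_cancel_right] at h1 h2
  simp only [wronskian]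
  linear_combination φ (n + 1) * h2 - ψ (n + 1) * h1

/-! ### Wronskians at the ends and uniqueness of Jost solutions -/

theorem tendsto_a_cofinite (L : MarchenkoJacobi) : Tendsto L.a cofinite (𝓝 (1 / 2)) := by
  rw [tendsto_iff_norm_sub_tendsto_zero]
  refine squeeze_zero (fun n => norm_nonneg _) (fun n => ?_)
    L.summable_weighted.tendsto_cofinite_zero
  rw [Real.norm_eq_abs]
  have h1 := abs_nonneg (L.a n - 1 / 2)
  have h2 := abs_nonneg (L.b n)
  have h3 := abs_nonneg (n : ℝ)
  nlinarith [mul_nonneg h3 h1, mul_nonneg h3 h2]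

theorem tendsto_a_atTop (L : MarchenkoJacobi) : Tendsto L.a atTop (𝓝 (1 / 2)) :=
  L.tendsto_a_cofinite.mono_left (by rw [Int.cofinite_eq]; exact le_sup_right)

theorem tendsto_a_atBot (L : MarchenkoJacobi) : Tendsto L.a atBot (𝓝 (1 / 2)) :=
  L.tendsto_a_cofinite.mono_left (by rw [Int.cofinite_eq]; exact le_sup_left)

/-- A filter at an end of `ℤ`, along which `a` tends to `1 / 2`. -/
structure IsEnd (l : Filter ℤ) : Prop where
  neBot : l.NeBot
  succ : Tendsto (fun n : ℤ => n + 1) l l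
  tendsto_a : ∀ L : MarchenkoJacobi, Tendsto L.a l (𝓝 (1 / 2))

theorem isEnd_atTop : IsEnd atTop :=
  ⟨inferInstance, tendsto_atTop_add_const_right _ _ tendsto_id, tendsto_a_atTop⟩

theorem isEnd_atBot : IsEnd atBot :=
  ⟨inferInstance, tendsto_atBot_add_const_right _ _ tendsto_id, tendsto_a_atBot⟩

theorem ne_zero_of_norm_eq_one {z : ℂ} (hz : ‖z‖ = 1) : z ≠ 0 := by
  rintro rfl
  simp at hz

/-- After removing unimodular factors the Wronskian tends to `(1/2)(x * y - x * y)`. The edges `z =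
±1` are included, which gives uniqueness there and later drives the density argument. -/
theorem tendsto_wronskian_zero (L : MarchenkoJacobi) {l : Filter ℤ} (hl : IsEnd l) {z x y : ℂ}
    (hz : ‖z‖ = 1) {φ ψ : ℤ → ℂ} (hφ : Tendsto (fun n : ℤ => φ n * z ^ (-n)) l (𝓝 x))
    (hψ : Tendsto (fun n : ℤ => ψ n * z ^ (-n)) l (𝓝 y)) :
    Tendsto (L.wronskian φ ψ) l (𝓝 0) := by
  have hz0 := ne_zero_of_norm_eq_one hz
  have ha : Tendsto (fun n => (L.a n : ℂ)) l (𝓝 ((1 / 2 : ℝ) : ℂ)) :=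
    (Complex.continuous_ofReal.tendsto _).comp (hl.tendsto_a L)
  have key := (ha.mul ((hφ.mul (hψ.comp hl.succ)).sub ((hφ.comp hl.succ).mul hψ))).norm
  rw [mul_comm x y, sub_self, mul_zero, norm_zero] at key
  refine tendsto_zero_iff_norm_tendsto_zero.2 (key.congr fun n => ?_)
  have : (L.a n : ℂ) * (φ n * z ^ (-n) * (ψ (n + 1) * z ^ (-(n + 1))) -
      φ (n + 1) * z ^ (-(n + 1)) * (ψ n * z ^ (-n))) =
        L.wronskian φ ψ n * (z ^ (-n) * z ^ (-(n + 1))) := by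
    rw [wronskian]
    ring
  simp only [Function.comp_apply, this, norm_mul, norm_zpow, hz, one_zpow, mul_one]

theorem tendsto_wronskian_inv (L : MarchenkoJacobi) {l : Filter ℤ} (hl : IsEnd l) {z : ℂ}
    (hz : ‖z‖ = 1) {φ ψ : ℤ → ℂ} (hφ : Tendsto (fun n : ℤ => φ n * z ^ (-n)) l (𝓝 1))
    (hψ : Tendsto (fun n : ℤ => ψ n * z⁻¹ ^ (-n)) l (𝓝 1)) :
    Tendsto (L.wronskian φ ψ) l (𝓝 ((z⁻¹ - z) / 2)) := by
  have hz0 := ne_zero_of_norm_eq_one hz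
  have ha : Tendsto (fun n => (L.a n : ℂ)) l (𝓝 ((1 / 2 : ℝ) : ℂ)) :=
    (Complex.continuous_ofReal.tendsto _).comp (hl.tendsto_a L)
  have key := ha.mul (((hφ.mul (hψ.comp hl.succ)).mul_const z⁻¹).sub
    (((hφ.comp hl.succ).mul hψ).mul_const z))
  have hlim : ((1 / 2 : ℝ) : ℂ) * (1 * 1 * z⁻¹ - 1 * 1 * z) = (z⁻¹ - z) / 2 := by
    push_cast
    ring
  rw [hlim] at key
  refine key.congr fun n => ?_
  have hzn : z ^ n ≠ 0 := zpow_ne_zero _ hz0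
  simp only [Function.comp_apply, wronskian, inv_zpow, zpow_neg, inv_inv, zpow_add₀ hz0, zpow_one]
  field_simp

theorem wronskian_eq_site (L : MarchenkoJacobi) {z : ℂ} {φ ψ : ℤ → ℂ}
    (hφ : L.IsSolution z φ) (hψ : L.IsSolution z ψ) (m n : ℤ) :
    L.wronskian φ ψ n = L.wronskian φ ψ m := by
  rw [L.wronskian_eq_zero_site hφ hψ n, L.wronskian_eq_zero_site hφ hψ m]

theorem wronskian_eq_of_tendsto (L : MarchenkoJacobi) {l : Filter ℤ} (hl : IsEnd l) {z x : ℂ}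
    {φ ψ : ℤ → ℂ} (hφ : L.IsSolution z φ) (hψ : L.IsSolution z ψ)
    (h : Tendsto (L.wronskian φ ψ) l (𝓝 x)) (n : ℤ) : L.wronskian φ ψ n = x := by
  have := hl.neBot
  refine tendsto_nhds_unique (tendsto_const_nhds.congr fun m => ?_) h
  exact L.wronskian_eq_site hφ hψ m n

theorem IsJost.ne_zero {L : MarchenkoJacobi} {l : Filter ℤ} (hl : IsEnd l) {z : ℂ} {φ : ℤ → ℂ}
    (h : L.IsJost l z φ) : φ ≠ 0 := by
  rintro rfl
  have := hl.neBot
  have := h.2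
  simp at this

theorem IsJost.unique {L : MarchenkoJacobi} {l : Filter ℤ} (hl : IsEnd l) {z : ℂ} (hz : ‖z‖ = 1)
    {φ ψ : ℤ → ℂ} (hφ : L.IsJost l z φ) (hψ : L.IsJost l z ψ) : φ = ψ := by
  have := hl.neBot
  obtain ⟨c, hc⟩ := hφ.1.exists_eq_mul hψ.1 (hψ.ne_zero hl) (m := 0)
    (L.wronskian_eq_of_tendsto hl hφ.1 hψ.1 (L.tendsto_wronskian_zero hl hz hφ.2 hψ.2) 0)
  have h1 : Tendsto (fun n : ℤ => φ n * z ^ (-n)) l (𝓝 (c * 1)) :=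
    (hψ.2.const_mul c).congr fun n => by rw [hc n, mul_assoc]
  have h2 := tendsto_nhds_unique h1 hφ.2
  ext n
  rw [hc n, ← mul_one c, h2, one_mul]

/-! ### Tail sums of the perturbation -/

/-- The size of the perturbation of the free Jacobi matrix between the sites `n` and `n + 1`. -/
noncomputable def defect (L : MarchenkoJacobi) (n : ℕ) : ℝ := |L.a n - 1 / 2| + |L.b (n + 1)|

theorem defect_nonneg (L : MarchenkoJacobi) (n : ℕ) : 0 ≤ L.defect n := by
  unfold defect
  positivity

theorem summable_nat_shift {f : ℤ → ℝ} (hf : Summable f) (m : ℤ) :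
    Summable fun k : ℕ => f (k + m) :=
  hf.comp_injective (i := fun k : ℕ => (k : ℤ) + m)
    ((add_left_injective m).comp Nat.cast_injective)

theorem summable_defect (L : MarchenkoJacobi) :
    Summable fun n : ℕ => ((n : ℝ) + 1) * L.defect n := by
  refine Summable.of_nonneg_of_le (fun n => mul_nonneg (by positivity) (L.defect_nonneg n))
    (fun n => ?_) ((summable_nat_shift L.summable_weighted 0).add
      (summable_nat_shift L.summable_weighted 1))
  have hn : (0 : ℝ) ≤ n := n.cast_nonneg
  have hn1 : (0 : ℝ) ≤ (n : ℝ) + 1 := by positivity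
  have h1 := abs_nonneg (L.a n - 1 / 2)
  have h2 := abs_nonneg (L.b n)
  have h3 := abs_nonneg (L.a (n + 1) - 1 / 2)
  have h4 := abs_nonneg (L.b (n + 1))
  simp only [defect, add_zero]
  push_cast
  rw [abs_of_nonneg hn, abs_of_nonneg hn1]
  nlinarith [mul_nonneg hn1 h2, mul_nonneg hn1 h3]

theorem summable_weighted_defect_add (L : MarchenkoJacobi) (n : ℕ) :
    Summable fun k : ℕ => ((k : ℝ) + 1) * L.defect (k + n) := by
  refine Summable.of_nonneg_of_le (fun k => mul_nonneg (by positivity) (L.defect_nonneg _))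
    (fun k => ?_) ((summable_nat_add_iff n).2 L.summable_defect)
  refine mul_le_mul_of_nonneg_right ?_ (L.defect_nonneg _)
  push_cast
  linarith [(n.cast_nonneg : (0 : ℝ) ≤ n)]

theorem summable_defect_add (L : MarchenkoJacobi) (n : ℕ) :
    Summable fun k : ℕ => L.defect (k + n) := by
  refine Summable.of_nonneg_of_le (fun k => L.defect_nonneg _) (fun k => ?_)
    (L.summable_weighted_defect_add n)
  nlinarith [L.defect_nonneg (k + n), mul_nonneg (k.cast_nonneg : (0 : ℝ) ≤ k)
    (L.defect_nonneg (k + n))]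

/-- The tail sum of the defects. -/
noncomputable def tail (L : MarchenkoJacobi) (n : ℕ) : ℝ := ∑' k : ℕ, L.defect (k + n)

/-- The iterated tail sum of the defects. -/
noncomputable def tail₂ (L : MarchenkoJacobi) (n : ℕ) : ℝ :=
  ∑' k : ℕ, ((k : ℝ) + 1) * L.defect (k + n)

theorem tail_nonneg (L : MarchenkoJacobi) (n : ℕ) : 0 ≤ L.tail n :=
  tsum_nonneg fun _ => L.defect_nonneg _

theorem tail₂_nonneg (L : MarchenkoJacobi) (n : ℕ) : 0 ≤ L.tail₂ n :=
  tsum_nonneg fun _ => mul_nonneg (by positivity) (L.defect_nonneg _)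

theorem tail_eq (L : MarchenkoJacobi) (n : ℕ) : L.tail n = L.defect n + L.tail (n + 1) := by
  rw [tail, (L.summable_defect_add n).tsum_eq_zero_add, zero_add, tail]
  simp only [add_assoc, add_comm 1]

/-- Together with `tail_eq` this is the error budget of one backward step: the remainder grows by a
multiple of `defect n`, the solution's error by a multiple of `tail n`. -/
theorem tail₂_eq (L : MarchenkoJacobi) (n : ℕ) : L.tail₂ n = L.tail n + L.tail₂ (n + 1) := by
  have h := (L.summable_weighted_defect_add (n + 1)).tsum_add (L.summable_defect_add (n + 1))
  rw [tail₂, (L.summable_weighted_defect_add n).tsum_eq_zero_add, L.tail_eq n]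
  rw [← tail, ← tail₂] at h
  have h2 : ∀ k : ℕ, (((k + 1 : ℕ) : ℝ) + 1) * L.defect (k + 1 + n) =
      ((k : ℝ) + 1) * L.defect (k + (n + 1)) + L.defect (k + (n + 1)) := fun k => by
    rw [show k + 1 + n = k + (n + 1) by ring]
    push_cast
    ring
  simp only [h2, h, Nat.cast_zero, zero_add, one_mul]
  ring

theorem tail₂_antitone (L : MarchenkoJacobi) : Antitone L.tail₂ :=
  antitone_nat_of_succ_le fun n => by
    rw [L.tail₂_eq n]
    linarith [L.tail_nonneg n]

theorem tail_antitone (L : MarchenkoJacobi) : Antitone L.tail :=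
  antitone_nat_of_succ_le fun n => by
    rw [L.tail_eq n]
    linarith [L.defect_nonneg n]

theorem tendsto_tail₂ (L : MarchenkoJacobi) : Tendsto L.tail₂ atTop (𝓝 0) := by
  refine squeeze_zero L.tail₂_nonneg (fun n => ?_)
    (tendsto_sum_nat_add fun n : ℕ => ((n : ℝ) + 1) * L.defect n)
  refine (L.summable_weighted_defect_add n).tsum_le_tsum (fun k => ?_)
    ((summable_nat_add_iff n).2 L.summable_defect)
  refine mul_le_mul_of_nonneg_right ?_ (L.defect_nonneg _)
  push_cast
  linarith [(n.cast_nonneg : (0 : ℝ) ≤ n)]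

/-- The iterated tail contains `k` successive tails, each at least the last one. Used with `k` about
`1 / |z - e|`, this turns the first moment into a tail of size `|z - e|`. -/
theorem mul_tail_le (L : MarchenkoJacobi) (n k : ℕ) : k * L.tail (n + k) ≤ L.tail₂ n := by
  induction k generalizing n with
  | zero => simpa using L.tail₂_nonneg n
  | succ k ih =>
    have h1 := ih (n + 1)
    have h2 := L.tail_antitone (show n ≤ n + (k + 1) by omega)
    rw [L.tail₂_eq n]
    rw [show n + 1 + k = n + (k + 1) by ring] at h1
    push_cast
    linarith

theorem dist_eq (L M : MarchenkoJacobi) :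
    dist L M = ∑' n : ℤ, (1 + |(n : ℝ)|) * (|L.a n - M.a n| + |L.b n - M.b n|) := rfl

theorem tsum_nat_shift_le (L M : MarchenkoJacobi) (m : ℤ) :
    ∑' k : ℕ, (1 + |((k + m : ℤ) : ℝ)|) *
      (|L.a (k + m) - M.a (k + m)| + |L.b (k + m) - M.b (k + m)|) ≤ dist L M :=
  tsum_comp_le_tsum_of_inj (summable_sub L M) (fun n => by positivity)
    (i := fun k : ℕ => (k : ℤ) + m) ((add_left_injective m).comp Nat.cast_injective)

/-- Makes the smallness condition of the a priori bound stable near a given matrix. The factor 2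
arises because `defect` uses `a` and `b` at adjacent sites, so two shifted sums are compared with
the distance. -/
theorem tail₂_le_add_dist (L M : MarchenkoJacobi) (n : ℕ) :
    L.tail₂ n ≤ M.tail₂ n + 2 * dist L M := by
  have hs (m : ℤ) := summable_nat_shift (summable_sub L M) m
  have h := (M.summable_weighted_defect_add n).tsum_add ((hs n).add (hs (n + 1)))
  rw [(hs n).tsum_add (hs (n + 1))] at h
  have h1 := tsum_nat_shift_le L M n
  have h2 := tsum_nat_shift_le L M (n + 1)
  have h3 : L.tail₂ n ≤ _ := (L.summable_weighted_defect_add n).tsum_le_tsum (fun k => ?_)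
    ((M.summable_weighted_defect_add n).add ((hs n).add (hs (n + 1))))
  · rw [h] at h3
    simp only [Pi.sub_apply] at h3
    rw [← tail₂] at h3
    linarith
  · have hk : (0 : ℝ) ≤ k := k.cast_nonneg
    have hn : (0 : ℝ) ≤ n := n.cast_nonneg
    have e : ((k + n : ℕ) : ℤ) + 1 = k + (n + 1) := by push_cast; ring
    simp only [defect, Pi.sub_apply, e]
    push_cast
    rw [abs_of_nonneg (show (0 : ℝ) ≤ k + n by positivity),
      abs_of_nonneg (show (0 : ℝ) ≤ k + (n + 1) by positivity)]
    have ha := abs_sub_le (L.a (k + n)) (M.a (k + n)) (1 / 2)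
    have hb := abs_sub_abs_le_abs_sub (L.b (k + (n + 1))) (M.b (k + (n + 1)))
    have p1 := abs_nonneg (L.a (k + n) - M.a (k + n))
    have p2 := abs_nonneg (L.b (k + n) - M.b (k + n))
    have p3 := abs_nonneg (L.a (k + (n + 1)) - M.a (k + (n + 1)))
    have p4 := abs_nonneg (L.b (k + (n + 1)) - M.b (k + (n + 1)))
    have q1 := mul_le_mul_of_nonneg_left (add_le_add ha hb) (show (0 : ℝ) ≤ k + 1 by positivity)
    nlinarith [mul_nonneg hk p2, mul_nonneg hn p2, mul_nonneg hk p3, mul_nonneg hn p3,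
      mul_nonneg hn p1, mul_nonneg hn p4]

/-! ### A priori bound for the backward recursion -/

/-- Twice the difference `a n φ (n + 1) - (z / 2) φ n`, which vanishes for the free solution
`z ^ n`. -/
noncomputable def remainder (L : MarchenkoJacobi) (z : ℂ) (φ : ℤ → ℂ) (n : ℤ) : ℂ :=
  2 * L.a n * φ (n + 1) - z * φ n

/-- One step of the a priori estimate for the backward recursion. -/
theorem backward_step (L : MarchenkoJacobi) {z : ℂ} (hz : ‖z‖ = 1) {φ : ℤ → ℂ} {n : ℕ}
    (hφ : L.apply φ (n + 1) = (z + z⁻¹) / 2 * φ (n + 1)) (hn : 28 * L.tail₂ n ≤ 1)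
    (h1 : ‖φ (n + 1) - z ^ (n + 1)‖ ≤ 28 * L.tail₂ (n + 1))
    (h2 : ‖L.remainder z φ (n + 1)‖ ≤ 24 * L.tail (n + 1)) :
    ‖φ n - z ^ n‖ ≤ 28 * L.tail₂ n ∧ ‖L.remainder z φ n‖ ≤ 24 * L.tail n := by
  have hz0 := ne_zero_of_norm_eq_one hz
  have hT := L.tail_eq n
  have hE := L.tail₂_eq n
  have t0 := L.tail_nonneg (n + 1)
  have e0 := L.tail₂_nonneg (n + 1)
  have c0 := L.defect_nonneg n
  set T := L.tail (n + 1)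
  set E := L.tail₂ (n + 1)
  have hc : L.defect n = |L.a n - 1 / 2| + |L.b (n + 1)| := rfl
  set c := L.defect n
  have ha := abs_nonneg (L.a n - 1 / 2)
  have hb := abs_nonneg (L.b (n + 1))
  set A := |L.a n - 1 / 2| with hA
  set B := |L.b (n + 1)| with hB
  have hAl : -A ≤ L.a n - 1 / 2 := neg_abs_le _
  have hAu : L.a n - 1 / 2 ≤ A := le_abs_self _
  have hu : ‖φ (n + 1)‖ ≤ 2 := by
    have : ‖φ (n + 1)‖ ≤ ‖φ (n + 1) - z ^ (n + 1)‖ + ‖z ^ (n + 1)‖ := norm_le_norm_sub_add _ _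
    rw [norm_pow, hz, one_pow] at this
    linarith
  have hA' : ‖(2 * L.a n - 1 : ℂ)‖ = 2 * A := by
    rw [show (2 * L.a n - 1 : ℂ) = ((2 * (L.a n - 1 / 2) : ℝ) : ℂ) by push_cast; ring,
      Complex.norm_real, Real.norm_eq_abs, abs_mul, abs_of_pos (by norm_num : (0 : ℝ) < 2)]
  have hB' : ‖(L.b (n + 1) : ℂ)‖ = B := by rw [Complex.norm_real, Real.norm_eq_abs]
  have ha' : ‖(L.a n : ℂ)‖ = L.a n := by
    rw [Complex.norm_real, Real.norm_eq_abs, abs_of_pos (L.a_pos _)]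
  -- The recursion rewritten for the remainder: the old remainder has the unimodular coefficient
  -- `z`, and everything else is proportional to the perturbation.
  have hP : 2 * L.a n * L.remainder z φ n = (2 * L.a n - 1) * ((2 * L.a n - 1) + 2) * φ (n + 1) +
      2 * z * L.b (n + 1) * φ (n + 1) + z * L.remainder z φ (n + 1) := by
    have h := hφ
    simp only [apply, add_sub_cancel_right] at h
    simp only [remainder]
    have hzz : z * z⁻¹ = 1 := mul_inv_cancel₀ hz0
    linear_combination (-2 * z) * h - φ (n + 1) * hzz
  -- With `‖φ (n + 1)‖ ≤ 2` the perturbation terms are at most `8A² + 8A + 4B ≤ 10c`. The gap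
  -- between 10 and 24 pays for dividing by `2 * L.a n`, which may be below 1; then 28 is 24 plus
  -- the 4 from `(2 * L.a n - 1) * φ (n + 1)`.
  have hPn : 2 * L.a n * ‖L.remainder z φ n‖ ≤ 10 * c + 24 * T := by
    have h := congrArg norm hP
    rw [norm_mul, norm_mul, ha', Complex.norm_ofNat] at h
    rw [h]
    refine (norm_add₃_le).trans ?_
    simp only [norm_mul, hA', hB', hz, Complex.norm_ofNat, one_mul, mul_one]
    have h3 : ‖(2 * L.a n - 1 : ℂ) + 2‖ ≤ 2 * A + 2 := by
      refine (norm_add_le _ _).trans ?_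
      rw [hA', Complex.norm_ofNat]
    have h4 : 2 * A * ‖(2 * L.a n - 1 : ℂ) + 2‖ * ‖φ (n + 1)‖ ≤ 2 * A * (2 * A + 2) * 2 := by
      gcongr
    have h5 : 2 * B * ‖φ (n + 1)‖ ≤ 2 * B * 2 := by gcongr
    nlinarith
  have hPb : ‖L.remainder z φ n‖ ≤ 24 * L.tail n := by
    have p0 := norm_nonneg (L.remainder z φ n)
    have hpos : 0 < 2 * L.a n := by linarith [L.a_pos n]
    refine le_of_mul_le_mul_left (hPn.trans ?_) hpos
    rw [hT]
    nlinarith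
  refine ⟨?_, hPb⟩
  have hf : z * (φ n - z ^ n) = (φ (n + 1) - z ^ (n + 1)) + (2 * L.a n - 1) * φ (n + 1) -
      L.remainder z φ n := by
    simp only [remainder, pow_succ]
    ring
  have h := congrArg norm hf
  rw [norm_mul, hz, one_mul] at h
  rw [h]
  refine (norm_sub_le _ _).trans ((add_le_add_left (norm_add_le _ _) _).trans ?_)
  rw [norm_mul, hA']
  nlinarith

/-- The a priori estimate for the backward recursion from free data at a site `N`. -/
theorem backward_bound (L : MarchenkoJacobi) {z : ℂ} (hz : ‖z‖ = 1) {φ : ℤ → ℂ} {N : ℕ}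
    (hφ : ∀ n : ℤ, n ≤ N → L.apply φ n = (z + z⁻¹) / 2 * φ n) (h0 : φ N = z ^ N)
    (h1 : L.remainder z φ N = 0) {n : ℕ} (hnN : n ≤ N) (hn : 28 * L.tail₂ n ≤ 1) :
    ‖φ n - z ^ n‖ ≤ 28 * L.tail₂ n ∧ ‖L.remainder z φ n‖ ≤ 24 * L.tail n := by
  induction hnN using Nat.decreasingInduction with
  | self =>
    rw [h0, h1, sub_self, norm_zero]
    exact ⟨by linarith [L.tail₂_nonneg N], by linarith [L.tail_nonneg N]⟩
  | of_succ k hk ih =>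
    have h := ih (by linarith [L.tail₂_antitone k.le_succ])
    push_cast at h
    exact L.backward_step hz (hφ (k + 1) (by exact_mod_cast hk)) hn h.1 h.2

/-- The backward recursion can be solved from any data at the sites `N` and `N + 1`. -/
theorem exists_backward (L : MarchenkoJacobi) (z : ℂ) (N : ℤ) (x y : ℂ) :
    ∃ φ : ℤ → ℂ, φ N = x ∧ φ (N + 1) = y ∧
      ∀ n : ℤ, n ≤ N → L.apply φ n = (z + z⁻¹) / 2 * φ n := by
  -- The pair `g k` holds the values at the sites `N - k` and `N + 1 - k`.
  let g : ℕ → ℂ × ℂ := fun k => Nat.rec (x, y) (fun k p =>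
    ((((z + z⁻¹) / 2 - L.b (N - k)) * p.1 - L.a (N - k) * p.2) / L.a (N - k - 1), p.1)) k
  have hg : ∀ k : ℕ, g (k + 1) = ((((z + z⁻¹) / 2 - L.b (N - k)) * (g k).1 -
    L.a (N - k) * (g k).2) / L.a (N - k - 1), (g k).1) := fun k => rfl
  refine ⟨fun n => (g (N + 1 - n).toNat).2, ?_, ?_, fun n hn => ?_⟩
  · simp [hg, show g 0 = (x, y) from rfl]
  · simp [show g 0 = (x, y) from rfl]
  · obtain ⟨k, rfl⟩ : ∃ k : ℕ, n = N - k := ⟨(N - n).toNat, by omega⟩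
    have e1 : (N + 1 - (N - k - 1)).toNat = k + 1 + 1 := by omega
    have e2 : (N + 1 - (N - k)).toNat = k + 1 := by omega
    have e3 : (N + 1 - (N - k + 1)).toNat = k := by omega
    simp only [apply, e1, e2, e3, hg]
    field_simp [L.a_ne_zero]
    ring

/-! ### Existence and continuity of Jost solutions by compactness -/

theorem coeff_sub_le_dist (L M : MarchenkoJacobi) (n : ℤ) :
    |L.a n - M.a n| + |L.b n - M.b n| ≤ dist L M := by
  refine le_trans ?_ ((summable_sub L M).le_tsum n fun m _ => by positivity)
  refine le_mul_of_one_le_left (by positivity) ?_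
  linarith [abs_nonneg (n : ℝ)]

theorem continuous_a (n : ℤ) : Continuous fun L : MarchenkoJacobi => L.a n :=
  (LipschitzWith.of_dist_le_mul (K := 1) fun L M => by
    rw [Real.dist_eq, NNReal.coe_one, one_mul]
    linarith [coeff_sub_le_dist L M n, abs_nonneg (L.b n - M.b n)]).continuous

theorem continuous_b (n : ℤ) : Continuous fun L : MarchenkoJacobi => L.b n :=
  (LipschitzWith.of_dist_le_mul (K := 1) fun L M => by
    rw [Real.dist_eq, NNReal.coe_one, one_mul]
    linarith [coeff_sub_le_dist L M n, abs_nonneg (L.a n - M.a n)]).continuous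

theorem tendsto_mul_zpow_neg_iff {z : ℂ} (hz : ‖z‖ = 1) {φ : ℤ → ℂ} :
    Tendsto (fun n : ℤ => φ n * z ^ (-n)) atTop (𝓝 1) ↔
      Tendsto (fun n : ℕ => ‖φ n - z ^ n‖) atTop (𝓝 0) := by
  have hz0 := ne_zero_of_norm_eq_one hz
  rw [← Nat.map_cast_int_atTop, tendsto_map'_iff, tendsto_iff_norm_sub_tendsto_zero]
  refine tendsto_congr fun n => ?_
  have : φ n * z ^ (-(n : ℤ)) - 1 = (φ n - z ^ n) * z ^ (-(n : ℤ)) := by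
    rw [zpow_neg, zpow_natCast]
    field_simp
  rw [Function.comp_apply, this, norm_mul, norm_zpow, hz, one_zpow, mul_one]

/-- Approximate Jost solutions that are uniformly close to the free solutions converge to a Jost
solution. -/
theorem exists_isJost_limit {ι : Type*} (F : Ultrafilter ι) {L : MarchenkoJacobi}
    {Ls : ι → MarchenkoJacobi} {z : ℂ} {zs : ι → ℂ} (hz : ‖z‖ = 1)
    (hzs : ∀ᶠ i in F, ‖zs i‖ = 1) (hL : Tendsto Ls F (𝓝 L)) (hzt : Tendsto zs F (𝓝 z))
    {φ : ι → ℤ → ℂ}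
    (hφ : ∀ n, ∀ᶠ i in F, (Ls i).apply (φ i) n = (zs i + (zs i)⁻¹) / 2 * φ i n)
    {N : ℕ} {E : ℕ → ℝ} (hE : Tendsto E atTop (𝓝 0))
    (hb : ∀ n ≥ N, ∀ᶠ i in F, ‖φ i n - zs i ^ n‖ ≤ E n) :
    ∃ ψ : ℤ → ℂ, L.IsJost atTop z ψ ∧ ∀ n, Tendsto (fun i => φ i n) F (𝓝 (ψ n)) := by
  have hz0 := ne_zero_of_norm_eq_one hz
  have hA (n : ℤ) : Tendsto (fun i => ((Ls i).a n : ℂ)) F (𝓝 (L.a n)) :=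
    ((Complex.continuous_ofReal.comp (continuous_a n)).tendsto L).comp hL
  have hB (n : ℤ) : Tendsto (fun i => ((Ls i).b n : ℂ)) F (𝓝 (L.b n)) :=
    ((Complex.continuous_ofReal.comp (continuous_b n)).tendsto L).comp hL
  have hlam : Tendsto (fun i => (zs i + (zs i)⁻¹) / 2) F (𝓝 ((z + z⁻¹) / 2)) :=
    (hzt.add (hzt.inv₀ hz0)).div_const 2
  -- At far sites the bound confines the values to a compact ball, so they converge along the
  -- ultrafilter; the recursion then carries convergence to the left.
  have hfar : ∀ n : ℕ, N ≤ n → ∃ y, Tendsto (fun i => φ i n) F (𝓝 y) := fun n hn => by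
    have hmem : ∀ᶠ i in F, φ i n ∈ Metric.closedBall (0 : ℂ) (E n + 1) := by
      filter_upwards [hb n hn, hzs] with i h1 h2
      rw [mem_closedBall_zero_iff]
      have := norm_le_norm_sub_add (φ i n) (zs i ^ n)
      rw [norm_pow, h2, one_pow] at this
      linarith
    obtain ⟨y, -, hy⟩ := (isCompact_closedBall (0 : ℂ) (E n + 1)).ultrafilter_le_nhds
      (F.map fun i => φ i n) (le_principal_iff.2 hmem)
    exact ⟨y, hy⟩
  have hall : ∀ n : ℤ, ∃ y, Tendsto (fun i => φ i n) F (𝓝 y) := by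
    intro n
    rcases le_total (N : ℤ) n with hn | hn
    · lift n to ℕ using (by omega)
      exact hfar n (by exact_mod_cast hn)
    · suffices h : (∃ y, Tendsto (fun i => φ i n) F (𝓝 y)) ∧
          ∃ y, Tendsto (fun i => φ i (n + 1)) F (𝓝 y) from h.1
      induction n, hn using Int.leInductionDown with
      | base => exact ⟨hfar N le_rfl, by simpa using hfar (N + 1) N.le_succ⟩
      | pred k _ ih =>
        rw [sub_add_cancel]
        refine ⟨?_, ih.1⟩
        obtain ⟨⟨x, hx⟩, y, hy⟩ := ih
        refine ⟨_, ((((hlam.sub (hB k)).mul hx).sub ((hA k).mul hy)).div (hA (k - 1))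
          (L.a_ne_zero _)).congr' ?_⟩
        filter_upwards [hφ k] with i hi
        have h0 := (Ls i).a_ne_zero (k - 1)
        simp only [apply] at hi
        rw [Pi.div_apply, div_eq_iff h0]
        linear_combination -hi
  choose ψ hψ using hall
  refine ⟨ψ, ⟨fun n => ?_, ?_⟩, hψ⟩
  · refine tendsto_nhds_unique (Tendsto.congr' (hφ n) ?_) (hlam.mul (hψ n))
    exact (((hA _).mul (hψ _)).add ((hB _).mul (hψ _))).add ((hA _).mul (hψ _))
  · rw [tendsto_mul_zpow_neg_iff hz]
    refine squeeze_zero' (Eventually.of_forall fun n => norm_nonneg _) ?_ hE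
    filter_upwards [eventually_ge_atTop N] with n hn
    exact le_of_tendsto ((hψ n).sub (hzt.pow n)).norm (hb n hn)

theorem eventually_tail₂_le (L : MarchenkoJacobi) : ∃ N, ∀ n ≥ N, 28 * L.tail₂ n ≤ 1 := by
  have h := L.tendsto_tail₂.const_mul 28
  rw [mul_zero] at h
  exact eventually_atTop.1 (h.eventually_le_const one_pos)

theorem exists_isJost_bound (L : MarchenkoJacobi) {z : ℂ} (hz : ‖z‖ = 1) :
    ∃ ψ, L.IsJost atTop z ψ ∧ ∀ n : ℕ, 28 * L.tail₂ n ≤ 1 →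
      ‖ψ n - z ^ n‖ ≤ 28 * L.tail₂ n ∧ ‖L.remainder z ψ n‖ ≤ 24 * L.tail n := by
  -- The value at `N + 1` is chosen to make the remainder at `N` vanish.
  choose φ h0 h1 h2 using fun N : ℕ =>
    L.exists_backward z N (z ^ N) (z * z ^ N / (2 * L.a N))
  have hr (N : ℕ) : L.remainder z (φ N) N = 0 := by
    have := L.a_ne_zero N
    rw [remainder, h0, h1]
    field_simp
    simp
  let F : Ultrafilter ℕ := hyperfilter ℕ
  have hF : (F : Filter ℕ) ≤ atTop := by
    rw [← Nat.cofinite_eq_atTop]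
    exact hyperfilter_le_cofinite
  have hb : ∀ n : ℕ, 28 * L.tail₂ n ≤ 1 → ∀ᶠ N in F,
      ‖φ N n - z ^ n‖ ≤ 28 * L.tail₂ n ∧ ‖L.remainder z (φ N) n‖ ≤ 24 * L.tail n := fun n hn =>
    hF <| (eventually_ge_atTop n).mono fun N hN =>
      L.backward_bound hz (h2 N) (h0 N) (hr N) hN hn
  obtain ⟨N₀, hN₀⟩ := L.eventually_tail₂_le
  obtain ⟨ψ, hψ, hlim⟩ := exists_isJost_limit F (L := L) (Ls := fun _ => L) (zs := fun _ => z) hz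
    (Eventually.of_forall fun _ => hz) tendsto_const_nhds tendsto_const_nhds (φ := φ)
    (fun n => hF <| (eventually_ge_atTop n.toNat).mono fun N hN => h2 N n (by omega))
    (N := N₀) (E := fun n => 28 * L.tail₂ n) (by simpa using L.tendsto_tail₂.const_mul 28)
    (fun n hn => (hb n (hN₀ n hn)).mono fun _ h => h.1)
  refine ⟨ψ, hψ, fun n hn => ⟨?_, ?_⟩⟩
  · exact le_of_tendsto ((hlim n).sub_const _).norm ((hb n hn).mono fun _ h => h.1)
  · exact le_of_tendsto (((hlim (n + 1)).const_mul _).sub ((hlim n).const_mul _)).norm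
      ((hb n hn).mono fun _ h => h.2)

theorem IsJost.bound {L : MarchenkoJacobi} {z : ℂ} (hz : ‖z‖ = 1) {φ : ℤ → ℂ}
    (h : L.IsJost atTop z φ) {n : ℕ} (hn : 28 * L.tail₂ n ≤ 1) :
    ‖φ n - z ^ n‖ ≤ 28 * L.tail₂ n ∧ ‖L.remainder z φ n‖ ≤ 24 * L.tail n := by
  obtain ⟨ψ, hψ, hb⟩ := L.exists_isJost_bound hz
  rw [h.unique isEnd_atTop hz hψ]
  exact hb n hn

/-- Jost solutions depend continuously on the Jacobi matrix and on the spectral parameter. -/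
theorem tendsto_of_isJost_atTop {ι : Type*} {F : Filter ι} {L : MarchenkoJacobi}
    {Ls : ι → MarchenkoJacobi} {z : ℂ} {zs : ι → ℂ} (hz : ‖z‖ = 1)
    (hzs : ∀ᶠ i in F, ‖zs i‖ = 1) (hL : Tendsto Ls F (𝓝 L)) (hzt : Tendsto zs F (𝓝 z))
    {φ : ι → ℤ → ℂ} (hφ : ∀ᶠ i in F, (Ls i).IsJost atTop (zs i) (φ i))
    {ψ : ℤ → ℂ} (hψ : L.IsJost atTop z ψ) (n : ℤ) : Tendsto (fun i => φ i n) F (𝓝 (ψ n)) := by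
  rw [tendsto_iff_ultrafilter]
  intro G hG
  -- The slack `1 / (n + 1)` absorbs `2 * dist (Ls i) L`, which at each fixed `n` is eventually
  -- smaller.
  have hE : Tendsto (fun n : ℕ => 28 * (L.tail₂ n + 1 / ((n : ℝ) + 1))) atTop (𝓝 0) := by
    simpa using (L.tendsto_tail₂.add tendsto_one_div_add_atTop_nhds_zero_nat).const_mul 28
  obtain ⟨N, hN⟩ := eventually_atTop.1 (hE.eventually_le_const one_pos)
  have hdist : Tendsto (fun i => 2 * dist (Ls i) L) G (𝓝 0) := by
    simpa using ((tendsto_iff_dist_tendsto_zero.1 hL).mono_left hG).const_mul 2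
  obtain ⟨χ, hχ, hlim⟩ := exists_isJost_limit G hz (hG hzs) (hL.mono_left hG) (hzt.mono_left hG)
    (fun n => (hφ.filter_mono hG).mono fun i hi => hi.1 n) (N := N) hE (fun n hn => by
      filter_upwards [hφ.filter_mono hG, hzs.filter_mono hG,
        hdist.eventually_le_const (show (0 : ℝ) < 1 / ((n : ℝ) + 1) by positivity)] with i h1 h2 h3
      have h4 := tail₂_le_add_dist (Ls i) L n
      have h5 := hN n hn
      exact (h1.bound h2 (n := n) (by linarith)).1.trans (by linarith))
  rw [hψ.unique isEnd_atTop hz hχ]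
  exact hlim n

/-! ### Reflection of the line -/

/-- The reflection of a Jacobi matrix at the site `0`. -/
def reflect (L : MarchenkoJacobi) : MarchenkoJacobi where
  a n := L.a (-n - 1)
  b n := L.b (-n)
  a_pos n := L.a_pos _
  summable_weighted := by
    have h1 := (L.summable_weighted.comp_injective (i := fun n : ℤ => -n - 1)
      ((sub_left_injective (b := (1 : ℤ))).comp neg_injective)).mul_left 2
    have h2 := L.summable_weighted.comp_injective (neg_injective (G := ℤ))
    refine Summable.of_nonneg_of_le (fun n => by positivity) (fun n => ?_) (h1.add h2)
    simp only [Function.comp_apply]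
    push_cast
    have e1 : |(n : ℝ)| ≤ |-(n : ℝ) - 1| + 1 := by
      have := abs_sub_abs_le_abs_sub (-(n : ℝ)) 1
      rw [abs_neg, abs_one] at this
      linarith
    rw [abs_neg]
    have p1 := abs_nonneg (L.a (-n - 1) - 1 / 2)
    have p2 := abs_nonneg (L.b (-n - 1))
    have p3 := abs_nonneg (L.a (-n) - 1 / 2)
    have p4 := abs_nonneg (-(n : ℝ) - 1)
    have p5 := abs_nonneg (n : ℝ)
    nlinarith [mul_le_mul_of_nonneg_right e1 p1, mul_nonneg p4 p1, mul_nonneg p4 p2,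
      mul_nonneg p5 p3]

theorem reflect_reflect (L : MarchenkoJacobi) : L.reflect.reflect = L := by
  ext n <;> simp [reflect]

theorem dist_reflect_le (L M : MarchenkoJacobi) : dist L.reflect M.reflect ≤ 3 * dist L M := by
  have i1 : Function.Injective fun n : ℤ => -n - 1 :=
    (sub_left_injective (b := (1 : ℤ))).comp neg_injective
  have s1 := (summable_sub L M).comp_injective i1
  have s2 := (summable_sub L M).comp_injective (neg_injective (G := ℤ))
  have t1 := tsum_comp_le_tsum_of_inj (summable_sub L M) (fun n => by positivity) i1
  have t2 := tsum_comp_le_tsum_of_inj (summable_sub L M) (fun n => by positivity)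
    (neg_injective (G := ℤ))
  have h := (s1.mul_left 2).tsum_add s2
  rw [tsum_mul_left] at h
  have h3 : dist L.reflect M.reflect ≤ _ :=
    (summable_sub L.reflect M.reflect).tsum_le_tsum (fun n => ?_) ((s1.mul_left 2).add s2)
  · rw [h] at h3
    have e : dist L M =
      ∑' n : ℤ, (1 + |(n : ℝ)|) * (|(L.a - M.a) n| + |(L.b - M.b) n|) := rfl
    rw [← e] at t1 t2
    linarith
  · simp only [Function.comp_apply, Pi.sub_apply, reflect]
    push_cast
    have e1 : |(n : ℝ)| ≤ |-(n : ℝ) - 1| + 1 := by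
      have := abs_sub_abs_le_abs_sub (-(n : ℝ)) 1
      rw [abs_neg, abs_one] at this
      linarith
    rw [abs_neg]
    have p1 := abs_nonneg (L.a (-n - 1) - M.a (-n - 1))
    have p2 := abs_nonneg (L.b (-n - 1) - M.b (-n - 1))
    have p3 := abs_nonneg (L.a (-n) - M.a (-n))
    have p4 := abs_nonneg (-(n : ℝ) - 1)
    have p5 := abs_nonneg (n : ℝ)
    nlinarith [mul_le_mul_of_nonneg_right e1 p1, mul_nonneg p4 p1, mul_nonneg p4 p2,
      mul_nonneg p5 p3]

theorem continuous_reflect : Continuous reflect :=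
  (LipschitzWith.of_dist_le_mul (K := 3) dist_reflect_le).continuous

theorem IsSolution.reflect {L : MarchenkoJacobi} {z : ℂ} {φ : ℤ → ℂ} (h : L.IsSolution z φ) :
    L.reflect.IsSolution z (fun n => φ (-n)) := fun n => by
  have := h.eq (-n)
  simp only [apply, MarchenkoJacobi.reflect]
  rw [← this, show -(n - 1) - 1 = -n by ring, show -(n - 1) = -n + 1 by ring,
    show -(n + 1) = -n - 1 by ring]
  ring

theorem wronskian_reflect (L : MarchenkoJacobi) (φ ψ : ℤ → ℂ) (n : ℤ) :
    L.reflect.wronskian (fun n => φ (-n)) (fun n => ψ (-n)) n = -L.wronskian φ ψ (-n - 1) := by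
  simp only [wronskian, MarchenkoJacobi.reflect, show -(n + 1) = -n - 1 by ring,
    show -n - 1 + 1 = -n by ring]
  ring

theorem IsJost.reflect_atBot {L : MarchenkoJacobi} {z : ℂ} {φ : ℤ → ℂ}
    (h : L.IsJost atBot z⁻¹ φ) : L.reflect.IsJost atTop z (fun n => φ (-n)) := by
  refine ⟨by simpa using h.1.inv.reflect, (h.2.comp tendsto_neg_atTop_atBot).congr fun n => ?_⟩
  simp

theorem IsJost.reflect_atTop {L : MarchenkoJacobi} {z : ℂ} {φ : ℤ → ℂ}
    (h : L.IsJost atTop z φ) : L.reflect.IsJost atBot z⁻¹ (fun n => φ (-n)) := by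
  refine ⟨h.1.inv.reflect, (h.2.comp tendsto_neg_atBot_atTop).congr fun n => ?_⟩
  simp

theorem isJost_jostRightPlus (L : MarchenkoJacobi) {z : ℂ} (hz : ‖z‖ = 1) :
    L.IsJost atTop z (L.jostRightPlus z) :=
  Classical.epsilon_spec ((L.exists_isJost_bound hz).imp fun _ h => h.1)

theorem isJost_jostRightMinus (L : MarchenkoJacobi) {z : ℂ} (hz : ‖z‖ = 1) :
    L.IsJost atTop z⁻¹ (L.jostRightMinus z) :=
  L.isJost_jostRightPlus (by rw [norm_inv, hz, inv_one])

theorem isJost_jostLeftMinus (L : MarchenkoJacobi) {z : ℂ} (hz : ‖z‖ = 1) :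
    L.IsJost atBot z⁻¹ (L.jostLeftMinus z) := by
  obtain ⟨ψ, hψ, -⟩ := L.reflect.exists_isJost_bound hz
  have := hψ.reflect_atTop
  rw [reflect_reflect] at this
  exact Classical.epsilon_spec ⟨_, this⟩

theorem tendsto_of_isJost_atBot {ι : Type*} {F : Filter ι} {L : MarchenkoJacobi}
    {Ls : ι → MarchenkoJacobi} {z : ℂ} {zs : ι → ℂ} (hz : ‖z‖ = 1)
    (hzs : ∀ᶠ i in F, ‖zs i‖ = 1) (hL : Tendsto Ls F (𝓝 L)) (hzt : Tendsto zs F (𝓝 z))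
    {φ : ι → ℤ → ℂ} (hφ : ∀ᶠ i in F, (Ls i).IsJost atBot (zs i)⁻¹ (φ i))
    {ψ : ℤ → ℂ} (hψ : L.IsJost atBot z⁻¹ ψ) (n : ℤ) :
    Tendsto (fun i => φ i n) F (𝓝 (ψ n)) := by
  simpa using tendsto_of_isJost_atTop hz hzs ((continuous_reflect.tendsto L).comp hL) hzt
    (hφ.mono fun i hi => hi.reflect_atBot) hψ.reflect_atBot (-n)

/-! ### Conjugation and unitarity -/

open ComplexConjugate

theorem IsJost.conj {L : MarchenkoJacobi} {l : Filter ℤ} {z : ℂ} (hz : ‖z‖ = 1) {φ : ℤ → ℂ}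
    (h : L.IsJost l z φ) : L.IsJost l z⁻¹ (fun n => conj (φ n)) := by
  have hc : conj z = z⁻¹ := (Complex.inv_eq_conj hz).symm
  have hc' : conj z⁻¹ = z := by rw [map_inv₀, hc, inv_inv]
  refine ⟨fun n => ?_, ?_⟩
  · have := congrArg conj (h.1.eq n)
    simp only [map_add, map_mul, map_div₀, Complex.conj_ofReal, hc, hc', map_ofNat] at this
    rw [apply, this, inv_inv]
  · have := (Complex.continuous_conj.tendsto 1).comp h.2
    simpa [Function.comp_def, hc] using this

theorem conj_wronskian (L : MarchenkoJacobi) (φ ψ : ℤ → ℂ) (n : ℤ) :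
    conj (L.wronskian φ ψ n) =
      L.wronskian (fun n => conj (φ n)) (fun n => conj (ψ n)) n := by
  simp [wronskian]

/-- Unitarity of the scattering matrix, in terms of Wronskians. -/
theorem normSq_wronskian (L : MarchenkoJacobi) {z : ℂ} (hz : ‖z‖ = 1) {φ χ ψ : ℤ → ℂ}
    (hφ : L.IsJost atTop z φ) (hχ : L.IsJost atTop z⁻¹ χ) (hψ : L.IsJost atBot z⁻¹ ψ) (n : ℤ) :
    ‖L.wronskian φ ψ n‖ ^ 2 = ‖L.wronskian ψ χ n‖ ^ 2 + (‖z - z⁻¹‖ / 2) ^ 2 := by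
  have hz' : ‖z⁻¹‖ = 1 := by rw [norm_inv, hz, inv_one]
  obtain rfl := hχ.unique isEnd_atTop hz' (hφ.conj hz)
  have hψ' := hψ.conj hz'
  have h1 := L.wronskian_eq_of_tendsto isEnd_atTop hφ.1 (by simpa using hχ.1.inv)
    (L.tendsto_wronskian_inv isEnd_atTop hz hφ.2 hχ.2) n
  have h2 := L.wronskian_eq_of_tendsto isEnd_atBot hψ.1 (by simpa using hψ'.1.inv)
    (L.tendsto_wronskian_inv isEnd_atBot hz' hψ.2 hψ'.2) n
  have h3 := L.conj_wronskian φ ψ n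
  have h4 := L.conj_wronskian ψ (fun n => conj (φ n)) n
  have h5 : conj (z - z⁻¹) = z⁻¹ - z := by
    rw [map_sub, map_inv₀, ← Complex.inv_eq_conj hz, inv_inv]
  have h6 : ‖z - z⁻¹‖ / 2 = ‖(z - z⁻¹) / 2‖ := by rw [norm_div, Complex.norm_ofNat]
  rw [h6]
  apply Complex.ofReal_injective
  push_cast
  simp only [← Complex.mul_conj', h3, h4, map_div₀, map_ofNat, h5]
  rw [inv_inv] at h2
  have h7 : (z - z⁻¹) / 2 * ((z⁻¹ - z) / 2) = ((z⁻¹ - z) / 2) * ((z - z⁻¹) / 2) := mul_comm _ _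
  -- What remains is the Plücker identity for the four sequences `φ`, `ψ` and their conjugates.
  rw [h7, ← h1, ← h2]
  simp only [wronskian, Complex.conj_conj]
  ring

/-! ### Wronskians near a band edge -/

theorem norm_edge {e : ℂ} (he : e ^ 2 = 1) : ‖e‖ = 1 := by
  have := congrArg norm he
  rw [norm_pow, norm_one] at this
  exact (pow_eq_one_iff_of_nonneg (norm_nonneg _) two_ne_zero).1 this

theorem edge_inv {e : ℂ} (he : e ^ 2 = 1) : e⁻¹ = e :=
  inv_eq_of_mul_eq_one_left (by rw [← sq, he])

/-- The energy has a critical point at the edge, so the energy gap is quadratic in `z - e`. -/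
theorem sub_eq_neg_sq_div {z e : ℂ} (hz : z ≠ 0) (he : e ^ 2 = 1) :
    (e + e⁻¹) / 2 - (z + z⁻¹) / 2 = -((z - e) ^ 2 / (2 * z)) := by
  rw [edge_inv he]
  field_simp
  linear_combination he

theorem IsJost.norm_le_two {L : MarchenkoJacobi} {z : ℂ} (hz : ‖z‖ = 1) {φ : ℤ → ℂ}
    (h : L.IsJost atTop z φ) {n : ℕ} (hn : 28 * L.tail₂ n ≤ 1) : ‖φ n‖ ≤ 2 := by
  have := norm_le_norm_sub_add (φ n) (z ^ n)
  rw [norm_pow, hz, one_pow] at this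
  linarith [(h.bound hz hn).1]

/-- Near a band edge, the Wronskian of two Jost solutions at the same end is at most of the size
of the distance to the edge. -/
theorem norm_wronskian_edge_le (L : MarchenkoJacobi) {z e : ℂ} (hz : ‖z‖ = 1) (he : e ^ 2 = 1)
    (hze : z ≠ e) {φ ψ : ℤ → ℂ} (hφ : L.IsJost atTop z φ) (hψ : L.IsJost atTop e ψ) {n : ℕ}
    (hn : 28 * L.tail₂ n ≤ 1) : ‖L.wronskian φ ψ n‖ ≤ 10 * ‖z - e‖ := by
  have he1 := norm_edge he
  set k := ‖z - e‖ with hk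
  have hk0 : 0 < k := norm_pos_iff.2 (sub_ne_zero.2 hze)
  have hk2 : k ≤ 2 := by
    have := norm_sub_le z e
    linarith
  have hbig (j : ℕ) : 28 * L.tail₂ (n + j) ≤ 1 := by
    linarith [L.tail₂_antitone (show n ≤ n + j by omega)]
  have hstep (j : ℕ) : ‖L.wronskian φ ψ (n + j : ℕ) - L.wronskian φ ψ n‖ ≤ j * (2 * k ^ 2) := by
    induction j with
    | zero => simp
    | succ j ih =>
      have h := L.wronskian_succ_sub hφ.1 hψ.1 (n + j : ℕ)
      rw [sub_eq_neg_sq_div (ne_zero_of_norm_eq_one hz) he] at h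
      have h' := congrArg norm h
      rw [norm_mul, norm_neg, norm_div, norm_mul, norm_mul, norm_pow, hz, Complex.norm_ofNat] at h'
      have h1 := hφ.norm_le_two hz (hbig (j + 1))
      have h2 := hψ.norm_le_two he1 (hbig (j + 1))
      have e1 : ((n + (j + 1) : ℕ) : ℤ) = (n + j : ℕ) + 1 := by push_cast; ring
      rw [e1] at h1 h2 ⊢
      have h3 : ‖φ ((n + j : ℕ) + 1)‖ * ‖ψ ((n + j : ℕ) + 1)‖ ≤ 2 * 2 := by gcongr
      have h4 := norm_sub_le_norm_sub_add_norm_sub (L.wronskian φ ψ ((n + j : ℕ) + 1))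
        (L.wronskian φ ψ (n + j : ℕ)) (L.wronskian φ ψ n)
      have h5 := mul_le_mul_of_nonneg_left h3 (sq_nonneg k)
      push_cast at *
      nlinarith
  -- Balance of two costs: `N` steps of size `2k²` add up to `2k(1 + k) ≤ 6k`, and after them the
  -- tail is at most `k / 28`, so the Wronskian there is at most `4k`. The sum is `10k`.
  set N := ⌈1 / k⌉₊ with hN
  have hN1 : 1 / k ≤ N := Nat.le_ceil _
  have hN2 : (N : ℝ) < 1 / k + 1 := Nat.ceil_lt_add_one (by positivity)
  have hN3 : 1 ≤ N * k := by rwa [div_le_iff₀ hk0] at hN1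
  have hN4 : N * k ≤ 1 + k := by
    have := mul_le_mul_of_nonneg_right hN2.le hk0.le
    rwa [add_mul, div_mul_cancel₀ _ hk0.ne', one_mul] at this
  have hT : 28 * L.tail (n + N) ≤ k := by
    have h1 := L.mul_tail_le n N
    have h2 := L.tail_nonneg (n + N)
    nlinarith [mul_le_mul_of_nonneg_right hN3 h2]
  have hend : ‖L.wronskian φ ψ ((n + N : ℕ) : ℤ)‖ ≤ 2 * k + 48 * L.tail (n + N) := by
    have h1 := hφ.norm_le_two hz (hbig N)
    have h2 := hψ.norm_le_two he1 (hbig N)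
    have h3 := (hφ.bound hz (hbig N)).2
    have h4 := (hψ.bound he1 (hbig N)).2
    set m : ℤ := ((n + N : ℕ) : ℤ)
    have h : 2 * L.wronskian φ ψ m = φ m * ψ m * (e - z) + φ m * L.remainder e ψ m -
        ψ m * L.remainder z φ m := by
      simp only [wronskian, remainder]
      ring
    have h' := congrArg norm h
    rw [norm_mul, Complex.norm_ofNat] at h'
    have h5 : ‖φ m * ψ m * (e - z) + φ m * L.remainder e ψ m - ψ m * L.remainder z φ m‖ ≤
        2 * 2 * k + 2 * (24 * L.tail (n + N)) + 2 * (24 * L.tail (n + N)) := by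
      refine (norm_sub_le _ _).trans (add_le_add ((norm_add_le _ _).trans (add_le_add ?_ ?_)) ?_)
      · rw [norm_mul, norm_mul, norm_sub_rev]
        gcongr
      · rw [norm_mul]
        gcongr
      · rw [norm_mul]
        gcongr
    linarith
  have h1 := hstep N
  have h2 := norm_le_norm_add_norm_sub (L.wronskian φ ψ (n + N : ℕ)) (L.wronskian φ ψ n)
  nlinarith

/-- The unit circle without `1` and `-1`, near the point `e`. -/
noncomputable abbrev circleNhds (e : ℂ) : Filter ℂ := 𝓝[Metric.sphere (0 : ℂ) 1 \ {1, -1}] e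

theorem eventually_circleNhds {e : ℂ} (he : e ^ 2 = 1) :
    ∀ᶠ z in circleNhds e, ‖z‖ = 1 ∧ z ≠ e ∧ z ≠ -e := by
  filter_upwards [self_mem_nhdsWithin] with z hz
  have h1 : ‖z‖ = 1 := by simpa using hz.1
  have h2 : z ≠ 1 ∧ z ≠ -1 := by simpa using hz.2
  rcases eq_or_eq_neg_of_sq_eq_sq e 1 (by rw [he, one_pow]) with rfl | rfl
  · exact ⟨h1, h2⟩
  · exact ⟨h1, h2.2, by simpa using h2.1⟩

theorem tendsto_circleNhds (e : ℂ) : Tendsto id (circleNhds e) (𝓝 e) :=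
  tendsto_id.mono_left nhdsWithin_le_nhds

/-- Excludes a vacuous limit: small arcs `e * exp(iθ)` with `θ > 0` avoid both edges. -/
theorem circleNhds_neBot {e : ℂ} (he : e ^ 2 = 1) : (circleNhds e).NeBot := by
  have h1 : Tendsto (fun θ : ℝ => e * Complex.exp (θ * Complex.I)) (𝓝[>] 0) (𝓝 e) := by
    have hc : Continuous fun θ : ℝ => e * Complex.exp (θ * Complex.I) := by fun_prop
    have := hc.tendsto 0
    simp only [Complex.ofReal_zero, zero_mul, Complex.exp_zero, mul_one] at this
    exact this.mono_left nhdsWithin_le_nhds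
  refine (tendsto_nhdsWithin_iff.2 ⟨h1, ?_⟩).neBot
  filter_upwards [Ioo_mem_nhdsGT Real.pi_pos] with θ hθ
  refine ⟨by simp [norm_edge he], fun hmem => ?_⟩
  have hsq : Complex.exp (θ * Complex.I) ^ 2 = 1 ^ 2 := by
    have : (e * Complex.exp (θ * Complex.I)) ^ 2 = 1 := by
      rcases hmem with h | h <;> rw [h] <;> norm_num
    rwa [mul_pow, he, one_mul, ← one_pow 2] at this
  have hsin := Real.sin_pos_of_pos_of_lt_pi hθ.1 hθ.2
  rw [← Complex.exp_ofReal_mul_I_im] at hsin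
  rcases eq_or_eq_neg_of_sq_eq_sq _ _ hsq with h | h <;> rw [h] at hsin <;> simp at hsin

/-- With two spectral parameters the Wronskian depends on the site, but for bounded values the
change is `O((z - e)²)`. -/
theorem isBigO_wronskian_succ_iff (L : MarchenkoJacobi) {e : ℂ} (he : e ^ 2 = 1)
    {φ : ℂ → ℤ → ℂ} {ψ : ℤ → ℂ} (hφ : ∀ᶠ z in circleNhds e, L.IsSolution z (φ z))
    (hψ : L.IsSolution e ψ) (n : ℤ)
    (hb : (fun z => φ z (n + 1)) =O[circleNhds e] (fun _ => (1 : ℂ))) :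
    (fun z => L.wronskian (φ z) ψ (n + 1)) =O[circleNhds e] (fun z => z - e) ↔
      (fun z => L.wronskian (φ z) ψ n) =O[circleNhds e] (fun z => z - e) := by
  have hdiff : (fun z => L.wronskian (φ z) ψ (n + 1) - L.wronskian (φ z) ψ n) =O[circleNhds e]
      (fun z => z - e) := by
    have h1 : (fun z : ℂ => (-((z - e) / (2 * z)) * ψ (n + 1))) =O[circleNhds e]
        (fun _ => (1 : ℂ)) := by
      refine Tendsto.isBigO_one ℂ (c := -((e - e) / (2 * e)) * ψ (n + 1)) ?_
      have he0 : 2 * e ≠ 0 := mul_ne_zero two_ne_zero (ne_zero_of_norm_eq_one (norm_edge he))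
      have hid : Tendsto (fun z : ℂ => z) (circleNhds e) (𝓝 e) := tendsto_circleNhds e
      exact ((hid.sub_const e).div (hid.const_mul 2) he0).neg.mul_const _
    have h2 := (h1.mul hb).mul (Asymptotics.isBigO_refl (fun z : ℂ => z - e) (circleNhds e))
    refine h2.congr' ?_ (Eventually.of_forall fun z => by ring)
    filter_upwards [hφ, eventually_circleNhds he] with z h3 h4
    have hz0 := ne_zero_of_norm_eq_one h4.1
    rw [L.wronskian_succ_sub h3 hψ, sub_eq_neg_sq_div hz0 he]
    field_simp
  exact ⟨fun h => by simpa using h.sub hdiff, fun h => by simpa using h.add hdiff⟩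

theorem isBigO_wronskian_of_bounded (L : MarchenkoJacobi) {e : ℂ} (he : e ^ 2 = 1)
    {φ : ℂ → ℤ → ℂ} {ψ : ℤ → ℂ} (hφ : ∀ᶠ z in circleNhds e, L.IsSolution z (φ z))
    (hψ : L.IsSolution e ψ)
    (hb : ∀ n, (fun z => φ z n) =O[circleNhds e] (fun _ => (1 : ℂ))) {m : ℤ}
    (hm : (fun z => L.wronskian (φ z) ψ m) =O[circleNhds e] (fun z => z - e)) (n : ℤ) :
    (fun z => L.wronskian (φ z) ψ n) =O[circleNhds e] (fun z => z - e) := by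
  induction n using Int.inductionOn' (b := m) with
  | zero => exact hm
  | succ k _ ih => exact (L.isBigO_wronskian_succ_iff he hφ hψ k (hb _)).2 ih
  | pred k _ ih =>
    exact (L.isBigO_wronskian_succ_iff he hφ hψ (k - 1) (hb _)).1 (by simpa using ih)

theorem tendsto_circleNhds_of_isJost (L : MarchenkoJacobi) {e : ℂ} (he : e ^ 2 = 1)
    {φ : ℂ → ℤ → ℂ} {ψ : ℤ → ℂ} (hφ : ∀ᶠ z in circleNhds e, L.IsJost atTop z (φ z))
    (hψ : L.IsJost atTop e ψ) (n : ℤ) : Tendsto (fun z => φ z n) (circleNhds e) (𝓝 (ψ n)) :=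
  tendsto_of_isJost_atTop (Ls := fun _ => L) (zs := id) (norm_edge he)
    ((eventually_circleNhds he).mono fun _ h => h.1) tendsto_const_nhds (tendsto_circleNhds e) hφ
    hψ n

theorem isBigO_wronskian_atTop (L : MarchenkoJacobi) {e : ℂ} (he : e ^ 2 = 1)
    {φ : ℂ → ℤ → ℂ} {ψ : ℤ → ℂ} (hφ : ∀ᶠ z in circleNhds e, L.IsJost atTop z (φ z))
    (hψ : L.IsJost atTop e ψ) (n : ℤ) :
    (fun z => L.wronskian (φ z) ψ n) =O[circleNhds e] (fun z => z - e) := by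
  obtain ⟨N, hN⟩ := L.eventually_tail₂_le
  refine L.isBigO_wronskian_of_bounded he (hφ.mono fun _ h => h.1) hψ.1
    (fun n => (L.tendsto_circleNhds_of_isJost he hφ hψ n).isBigO_one ℂ) (m := N) ?_ n
  refine Asymptotics.IsBigO.of_bound 10 ?_
  filter_upwards [hφ, eventually_circleNhds he] with z h1 h2
  exact L.norm_wronskian_edge_le h2.1 he h2.2.1 h1 hψ (hN N le_rfl)

theorem isBigO_wronskian_atBot (L : MarchenkoJacobi) {e : ℂ} (he : e ^ 2 = 1)
    {φ : ℂ → ℤ → ℂ} {ψ : ℤ → ℂ} (hφ : ∀ᶠ z in circleNhds e, L.IsJost atBot z⁻¹ (φ z))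
    (hψ : L.IsJost atBot e⁻¹ ψ) (n : ℤ) :
    (fun z => L.wronskian (φ z) ψ n) =O[circleNhds e] (fun z => z - e) := by
  have := L.reflect.isBigO_wronskian_atTop he (hφ.mono fun _ h => h.reflect_atBot)
    hψ.reflect_atBot (-n - 1)
  simp only [wronskian_reflect, show -(-n - 1) - 1 = n by ring] at this
  exact this.of_neg_left

/-! ### The band-edge criterion -/

/-- The Wronskian of the Jost solutions from the right and from the left. -/
noncomputable def jostWronskian (L : MarchenkoJacobi) (z : ℂ) : ℂ :=
  L.wronskian (L.jostRightPlus z) (L.jostLeftMinus z) 0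

theorem tendsto_wronskian {ι : Type*} {F : Filter ι} {L : MarchenkoJacobi}
    {Ls : ι → MarchenkoJacobi} (hL : Tendsto Ls F (𝓝 L)) {φ ψ : ι → ℤ → ℂ} {χ ω : ℤ → ℂ}
    (hφ : ∀ n, Tendsto (fun i => φ i n) F (𝓝 (χ n)))
    (hψ : ∀ n, Tendsto (fun i => ψ i n) F (𝓝 (ω n))) (n : ℤ) :
    Tendsto (fun i => (Ls i).wronskian (φ i) (ψ i) n) F (𝓝 (L.wronskian χ ω n)) :=
  (((Complex.continuous_ofReal.comp (continuous_a n)).tendsto L).comp hL).mul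
    (((hφ _).mul (hψ _)).sub ((hφ _).mul (hψ _)))

theorem continuous_jostWronskian {z : ℂ} (hz : ‖z‖ = 1) :
    Continuous fun L : MarchenkoJacobi => L.jostWronskian z :=
  continuous_iff_continuousAt.2 fun L => tendsto_wronskian tendsto_id
    (tendsto_of_isJost_atTop hz (Eventually.of_forall fun _ => hz) tendsto_id tendsto_const_nhds
      (Eventually.of_forall fun M => M.isJost_jostRightPlus hz) (L.isJost_jostRightPlus hz))
    (tendsto_of_isJost_atBot hz (Eventually.of_forall fun _ => hz) tendsto_id tendsto_const_nhds
      (Eventually.of_forall fun M => M.isJost_jostLeftMinus hz) (L.isJost_jostLeftMinus hz)) 0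

/-- The generic case: the Jost Wronskian does not vanish at the band edge. -/
theorem hasReflectionValue_of_ne_zero (L : MarchenkoJacobi) {e : ℂ} (he : e ^ 2 = 1)
    (h : L.jostWronskian e ≠ 0) : L.HasReflectionValue e (-1) := by
  have he1 := norm_edge he
  have hn : ∀ᶠ z in circleNhds e, ‖z‖ = 1 := (eventually_circleNhds he).mono fun _ h => h.1
  have h1 := L.tendsto_circleNhds_of_isJost he (hn.mono fun z hz => L.isJost_jostRightPlus hz)
    (L.isJost_jostRightPlus he1)
  have h2 : ∀ n, Tendsto (fun z => L.jostRightMinus z n) (circleNhds e)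
      (𝓝 (L.jostRightPlus e n)) := by
    have hinv : Tendsto (fun z : ℂ => z⁻¹) (circleNhds e) (𝓝 e) := by
      have := (tendsto_circleNhds e).inv₀ (ne_zero_of_norm_eq_one he1)
      rwa [edge_inv he] at this
    exact tendsto_of_isJost_atTop (Ls := fun _ => L) he1
      (hn.mono fun z hz => by rw [norm_inv, hz, inv_one]) tendsto_const_nhds hinv
      (hn.mono fun z hz => L.isJost_jostRightMinus hz) (L.isJost_jostRightPlus he1)
  have h3 : ∀ n, Tendsto (fun z => L.jostLeftMinus z n) (circleNhds e)
      (𝓝 (L.jostLeftMinus e n)) :=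
    tendsto_of_isJost_atBot (Ls := fun _ => L) (zs := id) he1 hn tendsto_const_nhds
      (tendsto_circleNhds e) (hn.mono fun z hz => L.isJost_jostLeftMinus hz)
      (L.isJost_jostLeftMinus he1)
  have key := (tendsto_wronskian (Ls := fun _ => L) tendsto_const_nhds h3 h2 0).div
    (tendsto_wronskian (Ls := fun _ => L) tendsto_const_nhds h1 h3 0) h
  have hval : L.wronskian (L.jostLeftMinus e) (L.jostRightPlus e) 0 /
      L.wronskian (L.jostRightPlus e) (L.jostLeftMinus e) 0 = -1 := by
    rw [jostWronskian] at h
    rw [div_eq_iff h]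
    simp only [wronskian]
    ring
  rw [hval] at key
  exact key

/-- The exceptional case: if the Jost Wronskian vanishes at the band edge, then it vanishes to
first order. -/
theorem isBigO_jostWronskian (L : MarchenkoJacobi) {e : ℂ} (he : e ^ 2 = 1)
    (h : L.jostWronskian e = 0) : L.jostWronskian =O[circleNhds e] (fun z => z - e) := by
  have he1 := norm_edge he
  have hn : ∀ᶠ z in circleNhds e, ‖z‖ = 1 := (eventually_circleNhds he).mono fun _ h => h.1
  have hr := L.isJost_jostRightPlus he1
  have hl := L.isJost_jostLeftMinus he1
  have hl' : L.IsSolution e (L.jostLeftMinus e) := by simpa using hl.1.inv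
  obtain ⟨c, hc⟩ := hr.1.exists_eq_mul hl' (hl.ne_zero isEnd_atBot) h
  have hrn := hn.mono fun z hz => L.isJost_jostRightPlus hz
  have hln := hn.mono fun z hz => L.isJost_jostLeftMinus hz
  have h1 := L.isBigO_wronskian_atTop he hrn hr 0
  have h2 := L.isBigO_wronskian_atBot he hln hl 0
  -- Three-term identity `W(r_z, l_z) r_e = W(r_z, r_e) l_z - W(l_z, r_e) r_z` with `r_e = c l_e`:
  -- both Wronskians on the right pair solutions from one end. It is read at the two sites entering
  -- the Wronskian at `0`.
  have key : ∀ m : ℤ, m = 0 ∨ m = 1 →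
      (fun z => L.jostWronskian z * L.jostRightPlus e m) =O[circleNhds e] (fun z => z - e) := by
    intro m hm
    have b1 := (tendsto_of_isJost_atTop (Ls := fun _ => L) (zs := id) he1 hn tendsto_const_nhds
      (tendsto_circleNhds e) hrn hr m).isBigO_one ℂ
    have b2 := (tendsto_of_isJost_atBot (Ls := fun _ => L) (zs := id) he1 hn tendsto_const_nhds
      (tendsto_circleNhds e) hln hl m).isBigO_one ℂ
    have h3 := (h1.mul b2).sub ((h2.const_mul_left c).mul b1)
    refine h3.congr (fun z => ?_) (fun z => by ring)
    simp only [jostWronskian, wronskian]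
    rcases hm with rfl | rfl <;> simp only [zero_add, hc] <;> ring
  have hne : ∃ m : ℤ, (m = 0 ∨ m = 1) ∧ L.jostRightPlus e m ≠ 0 := by
    by_contra! hcon
    exact hr.ne_zero isEnd_atTop (funext (hr.1.eq_zero (hcon 0 (Or.inl rfl))
      (hcon 1 (Or.inr rfl))))
  obtain ⟨m, hm, hm0⟩ := hne
  refine ((key m hm).const_mul_left (L.jostRightPlus e m)⁻¹).congr_left fun z => ?_
  field_simp

theorem not_hasReflectionValue_of_eq_zero (L : MarchenkoJacobi) {e : ℂ} (he : e ^ 2 = 1)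
    (h : L.jostWronskian e = 0) : ¬ L.HasReflectionValue e (-1) := by
  intro hR
  have := circleNhds_neBot he
  obtain ⟨C, hC, hb⟩ := (L.isBigO_jostWronskian he h).exists_pos
  have hid : Tendsto (fun z : ℂ => z) (circleNhds e) (𝓝 e) := tendsto_circleNhds e
  have h1 : Tendsto (fun z => ‖L.reflectionCoeff z‖ ^ 2 + ‖z + e‖ ^ 2 / (4 * C ^ 2))
      (circleNhds e) (𝓝 (‖(-1 : ℂ)‖ ^ 2 + ‖e + e‖ ^ 2 / (4 * C ^ 2))) :=
    ((Tendsto.norm hR).pow 2).add (((hid.add_const e).norm.pow 2).div_const _)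
  have h2 : ‖(-1 : ℂ)‖ ^ 2 + ‖e + e‖ ^ 2 / (4 * C ^ 2) ≤ 1 := by
    refine le_of_tendsto h1 ?_
    filter_upwards [eventually_circleNhds he, hb.bound] with z ⟨hz, hz1, hz2⟩ hzb
    have hz0 := ne_zero_of_norm_eq_one hz
    have h3 := L.normSq_wronskian hz (L.isJost_jostRightPlus hz) (L.isJost_jostRightMinus hz)
      (L.isJost_jostLeftMinus hz) 0
    have h4 : ‖z - z⁻¹‖ = ‖z - e‖ * ‖z + e‖ := by
      have : z - z⁻¹ = (z - e) * (z + e) * z⁻¹ := by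
        field_simp
        linear_combination he
      rw [this, norm_mul, norm_mul, norm_inv, hz, inv_one, mul_one]
    have p1 : 0 < ‖z - e‖ := norm_pos_iff.2 (sub_ne_zero.2 hz1)
    have p2 : 0 < ‖z + e‖ := norm_pos_iff.2 (by simpa [add_eq_zero_iff_eq_neg] using hz2)
    rw [reflectionCoeff, norm_div]
    rw [jostWronskian] at hzb
    rw [h4] at h3
    set W := ‖L.wronskian (L.jostRightPlus z) (L.jostLeftMinus z) 0‖
    set V := ‖L.wronskian (L.jostLeftMinus z) (L.jostRightMinus z) 0‖
    have hW0 : 0 ≤ W := norm_nonneg _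
    have hW : 0 < W ^ 2 := by rw [h3]; positivity
    have h5 : W ^ 2 ≤ C ^ 2 * ‖z - e‖ ^ 2 := by rw [← mul_pow]; gcongr
    have h6 : ‖z + e‖ ^ 2 / (4 * C ^ 2) ≤ (‖z - e‖ * ‖z + e‖ / 2) ^ 2 / W ^ 2 := by
      rw [div_le_div_iff₀ (by positivity) hW]
      nlinarith [mul_le_mul_of_nonneg_left h5 (sq_nonneg ‖z + e‖)]
    have h7 : (V / W) ^ 2 + (‖z - e‖ * ‖z + e‖ / 2) ^ 2 / W ^ 2 = 1 := by
      rw [div_pow, ← add_div, ← h3, div_self hW.ne']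
    linarith
  have h3 : 0 < ‖e + e‖ := by
    rw [← two_mul, norm_mul, norm_edge he, Complex.norm_ofNat]
    norm_num
  have h4 : 0 < ‖e + e‖ ^ 2 / (4 * C ^ 2) := by positivity
  rw [norm_neg, norm_one] at h2
  linarith

theorem hasReflectionValue_iff (L : MarchenkoJacobi) {e : ℂ} (he : e ^ 2 = 1) :
    L.HasReflectionValue e (-1) ↔ L.jostWronskian e ≠ 0 :=
  ⟨fun h h0 => L.not_hasReflectionValue_of_eq_zero he h0 h, L.hasReflectionValue_of_ne_zero he⟩

/-! ### Perturbing one diagonal entry -/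

/-- The Jacobi matrix with `t` added to the diagonal entry at the site `m`. -/
noncomputable def addDiag (L : MarchenkoJacobi) (m : ℤ) (t : ℝ) : MarchenkoJacobi where
  a := L.a
  b := Function.update L.b m (L.b m + t)
  a_pos := L.a_pos
  summable_weighted := by
    refine L.summable_weighted.congr_cofinite ?_
    filter_upwards [(Set.finite_singleton m).compl_mem_cofinite] with n hn
    rw [Function.update_of_ne hn]

theorem dist_addDiag (L : MarchenkoJacobi) (m : ℤ) (t : ℝ) :
    dist L (L.addDiag m t) = (1 + |(m : ℝ)|) * |t| := by
  rw [dist_eq, tsum_eq_single m]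
  · simp [addDiag]
  · intro n hn
    simp [addDiag, Function.update_of_ne hn]

theorem wronskian_succ_sub_addDiag (L : MarchenkoJacobi) {m : ℤ} {t : ℝ} {z : ℂ} {φ ψ : ℤ → ℂ}
    (hφ : L.IsSolution z φ) (hψ : (L.addDiag m t).IsSolution z ψ) (n : ℤ) :
    L.wronskian φ ψ (n + 1) - L.wronskian φ ψ n =
      (L.b (n + 1) - (L.addDiag m t).b (n + 1)) * (φ (n + 1) * ψ (n + 1)) := by
  have h1 := hφ.eq (n + 1)
  have h2 := hψ.eq (n + 1)
  simp only [add_sub_cancel_right, show (L.addDiag m t).a = L.a from rfl] at h1 h2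
  simp only [wronskian]
  linear_combination φ (n + 1) * h2 - ψ (n + 1) * h1

/-- If the Jost Wronskian vanishes, then there is a solution that is asymptotically free at both
ends. -/
theorem exists_of_jostWronskian_eq_zero (L : MarchenkoJacobi) {e : ℂ} (he : e ^ 2 = 1)
    (h : L.jostWronskian e = 0) : ∃ φ : ℤ → ℂ, L.IsSolution e φ ∧ φ ≠ 0 ∧
      (∃ x, Tendsto (fun n : ℤ => φ n * e ^ (-n)) atTop (𝓝 x)) ∧
      ∃ x, Tendsto (fun n : ℤ => φ n * e ^ (-n)) atBot (𝓝 x) := by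
  have hr := L.isJost_jostRightPlus (norm_edge he)
  have hl := L.isJost_jostLeftMinus (norm_edge he)
  rw [edge_inv he] at hl
  obtain ⟨c, hc⟩ := hr.1.exists_eq_mul hl.1 (hl.ne_zero isEnd_atBot) h
  refine ⟨_, hr.1, hr.ne_zero isEnd_atTop, ⟨1, hr.2⟩, c * 1, (hl.2.const_mul c).congr fun n => ?_⟩
  rw [hc n, mul_assoc]

/-- If both Wronskians vanished, the two doubly free solutions `φ`, `ψ` would have a mutual
Wronskian constant on each side of `m` and zero at both ends. Its jump `-t φ(m) ψ(m)` is then zero,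
forcing `ψ(m) = 0`, then `ψ(m + 1) = 0` and `ψ = 0`. -/
theorem jostWronskian_addDiag_ne_zero (L : MarchenkoJacobi) {e : ℂ} (he : e ^ 2 = 1)
    (h : L.jostWronskian e = 0) :
    ∃ m : ℤ, ∀ t : ℝ, t ≠ 0 → (L.addDiag m t).jostWronskian e ≠ 0 := by
  have he1 := norm_edge he
  obtain ⟨φ, hφ, hφ0, ⟨x, hx⟩, y, hy⟩ := L.exists_of_jostWronskian_eq_zero he h
  obtain ⟨m, hm⟩ := Function.ne_iff.1 hφ0
  refine ⟨m, fun t ht h' => ?_⟩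
  obtain ⟨ψ, hψ, hψ0, ⟨x', hx'⟩, y', hy'⟩ :=
    (L.addDiag m t).exists_of_jostWronskian_eq_zero he h'
  have hstep : ∀ n : ℤ, n + 1 ≠ m → L.wronskian φ ψ (n + 1) = L.wronskian φ ψ n := fun n hn => by
    have := L.wronskian_succ_sub_addDiag hφ hψ n
    rw [show (L.addDiag m t).b (n + 1) = L.b (n + 1) from Function.update_of_ne hn _ _, sub_self,
      zero_mul] at this
    exact sub_eq_zero.1 this
  have hup : ∀ n ≥ m, L.wronskian φ ψ n = L.wronskian φ ψ m := fun n hn => by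
    induction n, hn using Int.leInduction with
    | base => rfl
    | succ k hk ih => rw [hstep k (by omega), ih]
  have hdown : ∀ n ≤ m - 1, L.wronskian φ ψ n = L.wronskian φ ψ (m - 1) := fun n hn => by
    induction n, hn using Int.leInductionDown with
    | base => rfl
    | pred k hk ih => rw [← ih, ← hstep (k - 1) (by omega), sub_add_cancel]
  have h1 : L.wronskian φ ψ m = 0 :=
    tendsto_nhds_unique (tendsto_const_nhds.congr' ((eventually_ge_atTop m).mono fun n hn =>
      (hup n hn).symm)) (L.tendsto_wronskian_zero isEnd_atTop he1 hx hx')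
  have h2 : L.wronskian φ ψ (m - 1) = 0 :=
    tendsto_nhds_unique (tendsto_const_nhds.congr' ((eventually_le_atBot (m - 1)).mono fun n hn =>
      (hdown n hn).symm)) (L.tendsto_wronskian_zero isEnd_atBot he1 hy hy')
  have h3 := L.wronskian_succ_sub_addDiag hφ hψ (m - 1)
  rw [sub_add_cancel, h1, h2] at h3
  have hψm : ψ m = 0 := by
    simpa [addDiag, ht, show φ m ≠ 0 from hm] using h3
  have hψm1 : ψ (m + 1) = 0 := by
    simpa [wronskian, hψm, L.a_ne_zero, show φ m ≠ 0 from hm] using h1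
  exact hψ0 (funext (hψ.eq_zero hψm hψm1))

theorem isOpen_jostWronskian_ne_zero {e : ℂ} (he : e ^ 2 = 1) :
    IsOpen {L : MarchenkoJacobi | L.jostWronskian e ≠ 0} :=
  isOpen_ne.preimage (continuous_jostWronskian (norm_edge he))

theorem dense_jostWronskian_ne_zero {e : ℂ} (he : e ^ 2 = 1) :
    Dense {L : MarchenkoJacobi | L.jostWronskian e ≠ 0} := fun L => by
  by_cases h : L.jostWronskian e = 0
  · obtain ⟨m, hm⟩ := L.jostWronskian_addDiag_ne_zero he h
    rw [Metric.mem_closure_iff]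
    intro ε hε
    have hw : 0 < 1 + |(m : ℝ)| := by positivity
    have ht : 0 < ε / 2 / (1 + |(m : ℝ)|) := by positivity
    refine ⟨_, hm _ ht.ne', ?_⟩
    rw [dist_addDiag, abs_of_pos ht, mul_div_cancel₀ _ hw.ne']
    linarith
  · exact subset_closure h

end MarchenkoJacobi

theorem mainTheorem1 :
    IsOpen {L : MarchenkoJacobi | L.HasReflectionValue 1 (-1) ∧ L.HasReflectionValue (-1) (-1)} ∧
      Dense {L : MarchenkoJacobi |
        L.HasReflectionValue 1 (-1) ∧ L.HasReflectionValue (-1) (-1)} := by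
  have h1 : (1 : ℂ) ^ 2 = 1 := one_pow 2
  have h2 : (-1 : ℂ) ^ 2 = 1 := by norm_num
  simp only [MarchenkoJacobi.hasReflectionValue_iff _ h1,
    MarchenkoJacobi.hasReflectionValue_iff _ h2]
  exact ⟨(MarchenkoJacobi.isOpen_jostWronskian_ne_zero h1).inter
      (MarchenkoJacobi.isOpen_jostWronskian_ne_zero h2),
    (MarchenkoJacobi.dense_jostWronskian_ne_zero h1).inter_of_isOpen_left
      (MarchenkoJacobi.dense_jostWronskian_ne_zero h2)
      (MarchenkoJacobi.isOpen_jostWronskian_ne_zero h1)⟩
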